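/- **Setting.** Fix a set of variables, a set of values, and an imperative language whose operations are assume operations and assignments. A data state $c$ maps variables to values. $c\models b$ says that $c$ satisfies the assume operation $b$, and $SP_a(c)$ is the data state after the (always executable) assignment $a$. Every assignment $a$ has a set $\mathrm{wr}(a)$ of variables such that $a$ changes no variable outside $\mathrm{wr}(a)$. Every operation $op$ has a set $\mathrm{rd}(op)$ of variables such that, if $c,c'$ agree on $\mathrm{rd}(op)$, then $c\models op\Leftrightarrow c'\models op$ (assume), respectively $SP_{op}(c)$ and $SP_{op}(c')$ agree on $\mathrm{wr}(op)$ (assignment). A *control-flow automaton* (CFA) $P=(L,\ell_0,G,\ell_{err})$ has locations $L$, $\ell_0,\ell_{err}\in L$, and edges $G\subseteq L\times Ops\times L$. It is *deterministic* if any two edges $(\ell,op_1,\ell_1),(\ell,op_2,\ell_2)\in G$ satisfy either $op_1=op_2$ and $\ell_1=\ell_2$, or $op_1,op_2$ are assume operations with $op_1\equiv\neg op_2$. An *executable path* $(\ell_0,c_0)\xrightarrow{g_1}\cdots\xrightarrow{g_n}(\ell_n,c_n)$, $n\ge 0$, starts in the initial location with an arbitrary $c_0$, and for all $i$, $g_i=(\ell_{i-1},op_i,\ell_i)\in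 G$ with $c_{i-1}\models op_i$, $c_i=c_{i-1}$ (assume) or $c_i=SP_{op_i}(c_{i-1})$ (assignment). It is *erroneous* if some $\ell_i=\ell_{err}$. For CFAs $P$ and $P'=(L',\ell_0',G',\ell_{err}')$, $paths^{rb}(P,P')$ is the set of erroneous executable paths of $P'$ for which no erroneous executable path of $P$ starts with the same data state. A *difference graph* for $P,P'$ is a tuple $(N,E,n_0,\Delta)$ with $n_0\in N$, $\Delta\subseteq N$, $E\subseteq N\times G'\times N$ such that for every path in $paths^{rb}(P,P')$ with edges $g_1',\dots,g_n'$, every $0\le k\le n$ and every path $n_0\xrightarrow{g_1'}\cdots\xrightarrow{g_k'}n_k$ in the graph there is a (possibly empty) path in the graph from $n_k$ to a node of $\Delta$. **Detector.** Start with $\mathit{wait}=\mathit{visited}=\{(\ell_0,\ell_0')\}$, $\mathit{edges}=\Delta=\emptyset$ and $\mathit{mod}(n)=\emptyset$ for all $n\in L\times L'$. While $\mathit{wait}\ne\emptyset$, pop some $n=(\ell_1,\ell_1')$ from it and do the following, in some order, for each $g'=(\ell_1',op',\ell_2')\in G'$. * $op'$ is an assignment. If there is $(\ell_1,op',\ell_2)\in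 G$, call $\mathrm{process}(n,g',(\ell_2,\ell_2'),V)$, where $V=\mathit{mod}(n)\cup \mathrm{wr}(op')$ if $\mathit{mod}(n)\cap \mathrm{rd}(op')\neq\emptyset$ and $V=\mathit{mod}(n)\setminus \mathrm{wr}(op')$ otherwise. If there is no such edge, call $\mathrm{process}(n,g',(\ell_1,\ell_2'),\mathit{mod}(n)\cup \mathrm{wr}(op'))$. * $op'$ is an assume operation. Put $\ell_p=\ell_1$, $V=\mathit{mod}(n)$; while $\ell_p\ne\ell_{err}$ and there is an assignment edge $(\ell_p,a,\ell_s)\in G$, set $\ell_p:=\ell_s$, $V:=V\cup \mathrm{wr}(a)$. If then $\ell_p\neq\ell_{err}$ and there is $(\ell_p,op,\ell_2)\in G$ with $op=op'$, or with $op'\Rightarrow op$ and $op'$ satisfiable, call $\mathrm{process}(n,g',\ell_2',\emptyset)$ if $V\cap(\mathrm{rd}(op)\cup \mathrm{rd}(op'))\ne\emptyset$, and $\mathrm{process}(n,g',(\ell_2,\ell_2'),V)$ otherwise. If there is no such edge or $\ell_p=\ell_{err}$, call $\mathrm{process}(n,g',(\ell_p,\ell_2'),V)$. $\mathrm{process}(n,g',t,V)$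 with $t\in L'$: add $t$ to $\Delta$ and $(n,g',t)$ to $\mathit{edges}$, and remove all pairs with second component $t$ from $\mathit{visited}$ and $\mathit{wait}$. With $t=(\ell,\ell')\in L\times L'$: if $\ell\ne\ell_{err}$ and $\ell'=\ell'_{err}$, call $\mathrm{process}(n,g',\ell'_{err},\emptyset)$. Otherwise, if $\ell'\notin\Delta$, first add $t$ to $\mathit{wait}$ provided that $\ell\neq\ell_{err}$ and ($t\notin\mathit{visited}$ or $V\not\subseteq \mathit{mod}(t)$), then add $t$ to $\mathit{visited}$ and $V$ to $\mathit{mod}(t)$; in any case (also if $\ell'\in\Delta$) add $(n,g',t)$ to $\mathit{edges}$. When $\mathit{wait}=\emptyset$: if $\ell_0'\in\Delta$, or $\ell_0'=\ell_{err}'$ and $\ell_0\ne\ell_{err}$, return $(\{\ell_0'\},\emptyset,\ell_0',\{\ell_0'\})$. Otherwise return $(\mathit{visited}\cup\Delta,E,(\ell_0,\ell_0'),\Delta)$, where $E$ is the set of $(n,g',t)\in\mathit{visited}\times G'\times(\mathit{visited}\cup\Delta)$ such that $(n,g',t)\in\mathit{edges}$, or $t\in\Delta$ and $(n,g',(\ell,t))\in\mathit{edges}$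 for some $\ell\in L$. **Theorem.** Let $P$ and $P'$ be deterministic CFAs. Whenever the detector, run on $P$ and $P'$ with any order of exploration, terminates, the graph it returns is a difference graph for $P$ and $P'$. -/

import Mathlib

namespace DiffVerif

/-- An operation of the programming language: an assume operation (given by its condition)
or an assignment. -/
inductive Op (Cond Asgn : Type*) where
  | assume (b : Cond)
  | assign (a : Asgn)

/-- Semantics of an imperative language with assume operations `Cond` and assignments `Asgn` over
data states `Var → Val`.  `Sat c b` is `c ⊨ b`; `post a` is the strongest-post operator of `a` on
single data states.  The read and write sets are any sets with the characterizing properties: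
an assignment changes only variables in its write set, and agreement on the read set determines
the truth of a condition, respectively the values an assignment writes. -/
structure Semantics (Var Val Cond Asgn : Type*) where
  Sat : (Var → Val) → Cond → Prop
  post : Asgn → (Var → Val) → (Var → Val)
  rdCond : Cond → Set Var
  rdAsgn : Asgn → Set Var
  writ : Asgn → Set Var
  post_eq_of_notMem_writ : ∀ a c x, x ∉ writ a → post a c x = c x
  sat_congr : ∀ b c c', (∀ x ∈ rdCond b, c x = c' x) → (Sat c b ↔ Sat c' b)
  post_congr : ∀ a c c', (∀ x ∈ rdAsgn a, c x = c' x) → ∀ x ∈ writ a, post a c x = post a c' x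

/-- Syntactic control-flow edges `(ℓ, op, ℓ')`. -/
abbrev Edge (Loc Cond Asgn : Type*) := Loc × Op Cond Asgn × Loc

/-- Control-flow automata with location set `Loc`. -/
structure CFA (Loc Cond Asgn : Type*) where
  init : Loc
  err : Loc
  edges : Set (Edge Loc Cond Asgn)

section Programs

variable {Var Val Cond Asgn Loc Loc' : Type*}

/-- Any two edges leaving the same location are equal, or carry assume operations that are
(semantically) negations of each other. -/
def CFA.Deterministic (S : Semantics Var Val Cond Asgn) (P : CFA Loc Cond Asgn) : Prop :=
  ∀ ℓ op₁ ℓ₁ op₂ ℓ₂, (ℓ, op₁, ℓ₁) ∈ P.edges → (ℓ, op₂, ℓ₂) ∈ P.edges →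
    (op₁ = op₂ ∧ ℓ₁ = ℓ₂) ∨
    ∃ b₁ b₂, op₁ = .assume b₁ ∧ op₂ = .assume b₂ ∧ ∀ c, S.Sat c b₁ ↔ ¬ S.Sat c b₂

/-- Effect of executing one operation on the data state. -/
def OpStep (S : Semantics Var Val Cond Asgn) : Op Cond Asgn → (Var → Val) → (Var → Val) → Prop
  | .assume b, c, c' => S.Sat c b ∧ c' = c
  | .assign a, c, c' => c' = S.post a c

/-- Executable program paths `(loc 0, data 0) → … → (loc len, data len)`, where step `i` (counted
from `0`) takes the edge `edge i`.  The values of `loc`, `data` beyond `len` and of `edge` from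
`len` on carry no meaning. -/
structure ExecPath (S : Semantics Var Val Cond Asgn) (P : CFA Loc Cond Asgn) where
  len : ℕ
  loc : ℕ → Loc
  data : ℕ → Var → Val
  edge : ℕ → Edge Loc Cond Asgn
  loc_zero : loc 0 = P.init
  edge_mem : ∀ i < len, edge i ∈ P.edges
  edge_src : ∀ i < len, (edge i).1 = loc i
  edge_tgt : ∀ i < len, (edge i).2.2 = loc (i + 1)
  step : ∀ i < len, OpStep S (edge i).2.1 (data i) (data (i + 1))

/-- Executable paths that reach the error location. -/
def pathsErr (S : Semantics Var Val Cond Asgn) (P : CFA Loc Cond Asgn) : Set (ExecPath S P) :=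
  {π | ∃ i ≤ π.len, π.loc i = P.err}

/-- Paths of the modified program `P'` with a regression bug relative to `P`. -/
def pathsRB (S : Semantics Var Val Cond Asgn) (P : CFA Loc Cond Asgn) (P' : CFA Loc' Cond Asgn) :
    Set (ExecPath S P') :=
  {π' | π' ∈ pathsErr S P' ∧ ¬ ∃ π ∈ pathsErr S P, π'.data 0 = π.data 0}

end Programs

/-- A graph with nodes, labelled edges, an initial node, and indicator nodes `Δ`. -/
structure Graph (Node Label : Type*) where
  nodes : Set Node
  edges : Set (Node × Label × Node)
  init : Node
  Δ : Set Node

/-- `node 0 → … → node k` is a path of the graph with labels `label 0, …, label (k - 1)`. -/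
def Graph.IsWalk {Node Label : Type*} (D : Graph Node Label)
    (k : ℕ) (node : ℕ → Node) (label : ℕ → Label) : Prop :=
  (∀ i ≤ k, node i ∈ D.nodes) ∧ ∀ i < k, (node i, label i, node (i + 1)) ∈ D.edges

/-- `D` is a difference graph for original `P` and modified `P'`. -/
structure IsDifferenceGraph {Var Val Cond Asgn Loc Loc' Node : Type*}
    (S : Semantics Var Val Cond Asgn) (P : CFA Loc Cond Asgn) (P' : CFA Loc' Cond Asgn)
    (D : Graph Node (Edge Loc' Cond Asgn)) : Prop where
  init_mem : D.init ∈ D.nodes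
  indicator_subset : D.Δ ⊆ D.nodes
  edges_subset : ∀ n g n', (n, g, n') ∈ D.edges → n ∈ D.nodes ∧ g ∈ P'.edges ∧ n' ∈ D.nodes
  sound : ∀ π' ∈ pathsRB S P P', ∀ k ≤ π'.len, ∀ node : ℕ → Node,
    node 0 = D.init → D.IsWalk k node π'.edge →
      ∃ (m : ℕ) (node' : ℕ → Node) (label' : ℕ → Edge Loc' Cond Asgn),
        node' 0 = node k ∧ D.IsWalk m node' label' ∧ node' m ∈ D.Δ

/-! ### The difference detector -/

/-- Nodes handled by the detector: alignment points `(ℓ, ℓ')`, or a bare location `ℓ'` of the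
modified program (a regression bug indicator node). -/
inductive Node (Loc Loc' : Type*) where
  | aligned (n : Loc × Loc')
  | indicator (ℓ' : Loc')

/-- Values of the program variables of the detector. -/
structure State (Var Cond Asgn Loc Loc' : Type*) where
  waitlist : Set (Loc × Loc')
  visited : Set (Loc × Loc')
  edges : Set (Node Loc Loc' × Edge Loc' Cond Asgn × Node Loc Loc')
  bad : Set Loc'
  modified : Loc × Loc' → Set Var

section Detector

variable {Var Val Cond Asgn Loc Loc' : Type*}

/-- Initialization. -/
def State.start (P : CFA Loc Cond Asgn) (P' : CFA Loc' Cond Asgn) :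
    State Var Cond Asgn Loc Loc' where
  waitlist := {(P.init, P'.init)}
  visited := {(P.init, P'.init)}
  edges := ∅
  bad := ∅
  modified := fun _ => ∅

/-- Procedure `process` for a successor that is a location `ℓ'` of the modified program. -/
def State.processIndicator (s : State Var Cond Asgn Loc Loc') (pred : Loc × Loc')
    (g' : Edge Loc' Cond Asgn) (ℓ' : Loc') : State Var Cond Asgn Loc Loc' where
  waitlist := s.waitlist \ {n | n.2 = ℓ'}
  visited := s.visited \ {n | n.2 = ℓ'}
  edges := s.edges ∪ {(.aligned pred, g', .indicator ℓ')}
  bad := s.bad ∪ {ℓ'}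
  modified := s.modified

open Classical in
/-- Procedure `process (pred, g', succ) Vdiff`. -/
noncomputable def State.process (P : CFA Loc Cond Asgn) (P' : CFA Loc' Cond Asgn)
    (s : State Var Cond Asgn Loc Loc') (pred : Loc × Loc') (g' : Edge Loc' Cond Asgn)
    (succ : Node Loc Loc') (Vdiff : Set Var) : State Var Cond Asgn Loc Loc' :=
  match succ with
  | .indicator ℓ' => s.processIndicator pred g' ℓ'
  | .aligned n =>
    if n.1 ≠ P.err ∧ n.2 = P'.err then s.processIndicator pred g' P'.err
    else
      { waitlist :=
          if n.2 ∉ s.bad ∧ n.1 ≠ P.err ∧ (n ∉ s.visited ∨ ¬ Vdiff ⊆ s.modified n)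
          then s.waitlist ∪ {n} else s.waitlist
        visited := if n.2 ∉ s.bad then s.visited ∪ {n} else s.visited
        edges := s.edges ∪ {(.aligned pred, g', .aligned n)}
        bad := s.bad
        modified := fun k =>
          if k = n ∧ n.2 ∉ s.bad then s.modified k ∪ Vdiff else s.modified k }

/-- The resynchronization loop: starting with `ℓp = ℓ` and `Vdiff = V`, skip assignments of `P`
until the error location or a location without outgoing assignment is reached; the loop ends with
the last two arguments as values of `ℓp` and `Vdiff`. -/
inductive Resync (S : Semantics Var Val Cond Asgn) (P : CFA Loc Cond Asgn) :
    Loc → Set Var → Loc → Set Var → Prop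
  | done {ℓ V} : ¬ (ℓ ≠ P.err ∧ ∃ a ℓs, (ℓ, Op.assign a, ℓs) ∈ P.edges) → Resync S P ℓ V ℓ V
  | skip {ℓ V a ℓs ℓp W} : ℓ ≠ P.err → (ℓ, Op.assign a, ℓs) ∈ P.edges →
      Resync S P ℓs (V ∪ S.writ a) ℓp W → Resync S P ℓ V ℓp W

/-- The assume operation `b` of the original program matches the assume operation `b'`:
identical, or more general with `b'` satisfiable. -/
def Matches (S : Semantics Var Val Cond Asgn) (b b' : Cond) : Prop :=
  b = b' ∨ ((∀ c, S.Sat c b' → S.Sat c b) ∧ ∃ c, S.Sat c b')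

/-- Body of the for-loop: `ExploreEdge S P P' n g' s t` says that exploring the edge `g'` from the
popped alignment point `n` in detector state `s` may end in state `t`. -/
inductive ExploreEdge (S : Semantics Var Val Cond Asgn)
    (P : CFA Loc Cond Asgn) (P' : CFA Loc' Cond Asgn) (n : Loc × Loc') :
    Edge Loc' Cond Asgn → State Var Cond Asgn Loc Loc' → State Var Cond Asgn Loc Loc' → Prop
  | assignMatchAffected {s a ℓ₂ ℓ₂'} :
      (n.1, Op.assign a, ℓ₂) ∈ P.edges → s.modified n ∩ S.rdAsgn a ≠ ∅ →
      ExploreEdge S P P' n (n.2, .assign a, ℓ₂') s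
        (s.process P P' n (n.2, .assign a, ℓ₂') (.aligned (ℓ₂, ℓ₂')) (s.modified n ∪ S.writ a))
  | assignMatchUnaffected {s a ℓ₂ ℓ₂'} :
      (n.1, Op.assign a, ℓ₂) ∈ P.edges → s.modified n ∩ S.rdAsgn a = ∅ →
      ExploreEdge S P P' n (n.2, .assign a, ℓ₂') s
        (s.process P P' n (n.2, .assign a, ℓ₂') (.aligned (ℓ₂, ℓ₂')) (s.modified n \ S.writ a))
  | assignNew {s a ℓ₂'} :
      (¬ ∃ ℓ₂, (n.1, Op.assign a, ℓ₂) ∈ P.edges) →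
      ExploreEdge S P P' n (n.2, .assign a, ℓ₂') s
        (s.process P P' n (n.2, .assign a, ℓ₂') (.aligned (n.1, ℓ₂')) (s.modified n ∪ S.writ a))
  | assumeMatchAffected {s b' ℓ₂' ℓp Vdiff b ℓ₂} :
      Resync S P n.1 (s.modified n) ℓp Vdiff →
      ℓp ≠ P.err → (ℓp, Op.assume b, ℓ₂) ∈ P.edges → Matches S b b' →
      Vdiff ∩ (S.rdCond b ∪ S.rdCond b') ≠ ∅ →
      ExploreEdge S P P' n (n.2, .assume b', ℓ₂') s
        (s.process P P' n (n.2, .assume b', ℓ₂') (.indicator ℓ₂') ∅)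
  | assumeMatchUnaffected {s b' ℓ₂' ℓp Vdiff b ℓ₂} :
      Resync S P n.1 (s.modified n) ℓp Vdiff →
      ℓp ≠ P.err → (ℓp, Op.assume b, ℓ₂) ∈ P.edges → Matches S b b' →
      Vdiff ∩ (S.rdCond b ∪ S.rdCond b') = ∅ →
      ExploreEdge S P P' n (n.2, .assume b', ℓ₂') s
        (s.process P P' n (n.2, .assume b', ℓ₂') (.aligned (ℓ₂, ℓ₂')) Vdiff)
  | assumeNew {s b' ℓ₂' ℓp Vdiff} :
      Resync S P n.1 (s.modified n) ℓp Vdiff →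
      ¬ (ℓp ≠ P.err ∧ ∃ b ℓ₂, (ℓp, Op.assume b, ℓ₂) ∈ P.edges ∧ Matches S b b') →
      ExploreEdge S P P' n (n.2, .assume b', ℓ₂') s
        (s.process P P' n (n.2, .assume b', ℓ₂') (.aligned (ℓp, ℓ₂')) Vdiff)

/-- Exploring a list of edges one after the other. -/
inductive ExploreEdges (S : Semantics Var Val Cond Asgn)
    (P : CFA Loc Cond Asgn) (P' : CFA Loc' Cond Asgn) (n : Loc × Loc') :
    List (Edge Loc' Cond Asgn) →
      State Var Cond Asgn Loc Loc' → State Var Cond Asgn Loc Loc' → Prop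
  | nil {s} : ExploreEdges S P P' n [] s s
  | cons {g' gs s t u} : ExploreEdge S P P' n g' s t → ExploreEdges S P P' n gs t u →
      ExploreEdges S P P' n (g' :: gs) s u

/-- One iteration of the outer while-loop: pop some element of the waitlist and explore, in some
order, every edge of the modified program that leaves its second component. -/
def Iteration (S : Semantics Var Val Cond Asgn)
    (P : CFA Loc Cond Asgn) (P' : CFA Loc' Cond Asgn)
    (s t : State Var Cond Asgn Loc Loc') : Prop :=
  ∃ n ∈ s.waitlist, ∃ gs : List (Edge Loc' Cond Asgn),
    gs.Nodup ∧ (∀ g', g' ∈ gs ↔ g' ∈ P'.edges ∧ g'.1 = n.2) ∧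
    ExploreEdges S P P' n gs { s with waitlist := s.waitlist \ {n} } t

open Classical in
/-- Construction of the returned graph from the final detector state. -/
noncomputable def State.output (P : CFA Loc Cond Asgn) (P' : CFA Loc' Cond Asgn)
    (s : State Var Cond Asgn Loc Loc') : Graph (Node Loc Loc') (Edge Loc' Cond Asgn) :=
  if P'.init ∈ s.bad ∨ (P'.init = P'.err ∧ P.init ≠ P.err) then
    { nodes := {.indicator P'.init}
      edges := ∅
      init := .indicator P'.init
      Δ := {.indicator P'.init} }
  else
    { nodes := Node.aligned '' s.visited ∪ Node.indicator '' s.bad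
      edges := {e | e.1 ∈ Node.aligned '' s.visited ∧ e.2.1 ∈ P'.edges ∧
        e.2.2 ∈ Node.aligned '' s.visited ∪ Node.indicator '' s.bad ∧
        (e ∈ s.edges ∨
          ∃ ℓ' ∈ s.bad, e.2.2 = .indicator ℓ' ∧
            ∃ ℓ, (e.1, e.2.1, Node.aligned (ℓ, ℓ')) ∈ s.edges)}
      init := .aligned (P.init, P'.init)
      Δ := Node.indicator '' s.bad }

/-- `D` is returned by some (terminating) run of the detector on `P` and `P'`. -/
def DetectorReturns (S : Semantics Var Val Cond Asgn)
    (P : CFA Loc Cond Asgn) (P' : CFA Loc' Cond Asgn)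
    (D : Graph (Node Loc Loc') (Edge Loc' Cond Asgn)) : Prop :=
  ∃ s : State Var Cond Asgn Loc Loc',
    Relation.ReflTransGen (Iteration S P P') (State.start P P') s ∧
    s.waitlist = ∅ ∧ D = s.output P P'

end Detector

end DiffVerif

namespace DiffVerif

section Soundness

variable {Var Val Cond Asgn Loc Loc' : Type*}

/-! ### Executions of the original program -/

/-! The detector computes a simulation of `P'` by `P`: at an alignment point, `modified` bounds the
variables in which two runs started in the same data state may differ. Along a path with a
regression bug, `P` can therefore follow to the first component of every alignment point that is met
(`Successor.exists_reach`), and this is never `P.err`, since no execution from that data state is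
erroneous. A visited point whose second component is `P'.err` has first component `P.err`, or is the
initial one, a case treated separately. So the path cannot reach `P'.err` through visited points
only, and since every edge leaving a visited point has been explored, the step that leaves them
yields a graph edge into an indicator (`Invariant.reachesIndicator`).

The difficulty is that `edges` only grows, while points are evicted or explored again with more
modified variables, so a recorded edge may stem from an outdated exploration. By determinism of `P`,
the aligned successor along an executable edge does not depend on the modified variables
(`Successor.unique`). Hence a recorded edge between surviving points also arises from the latest
exploration of its source: otherwise that exploration would have produced an indicator and evicted
the target. `Invariant` holds what the latest exploration guarantees. -/

/-- `Reach S P c₀ ℓ c`: some execution of `P` starting with data state `c₀` ends in `(ℓ, c)`. -/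
inductive Reach (S : Semantics Var Val Cond Asgn) (P : CFA Loc Cond Asgn) (c₀ : Var → Val) :
    Loc → (Var → Val) → Prop
  | init : Reach S P c₀ P.init c₀
  | step {ℓ c op ℓ' c'} : Reach S P c₀ ℓ c → (ℓ, op, ℓ') ∈ P.edges → OpStep S op c c' →
      Reach S P c₀ ℓ' c'

/-- Extension of an executable path by one step. -/
def ExecPath.snoc {S : Semantics Var Val Cond Asgn} {P : CFA Loc Cond Asgn} (π : ExecPath S P)
    {op : Op Cond Asgn} {ℓ : Loc} {c : Var → Val} (he : (π.loc π.len, op, ℓ) ∈ P.edges)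
    (hc : OpStep S op (π.data π.len) c) : ExecPath S P where
  len := π.len + 1
  loc i := if i ≤ π.len then π.loc i else ℓ
  data i := if i ≤ π.len then π.data i else c
  edge i := if i < π.len then π.edge i else (π.loc π.len, op, ℓ)
  loc_zero := by simpa using π.loc_zero
  edge_mem i _ := by
    by_cases h : i < π.len
    · simpa [h] using π.edge_mem i h
    · simpa [h] using he
  edge_src i hi := by
    by_cases h : i < π.len
    · simpa [h, h.le] using π.edge_src i h
    · obtain rfl : i = π.len := by omega
      simp
  edge_tgt i hi := by
    by_cases h : i < π.len
    · simpa [h, Nat.succ_le_of_lt h] using π.edge_tgt i h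
    · obtain rfl : i = π.len := by omega
      simp
  step i hi := by
    by_cases h : i < π.len
    · simpa [h, h.le, Nat.succ_le_of_lt h] using π.step i h
    · obtain rfl : i = π.len := by omega
      simpa using hc

theorem Reach.exists_execPath [Nonempty (Op Cond Asgn)] {S : Semantics Var Val Cond Asgn}
    {P : CFA Loc Cond Asgn} {c₀ c : Var → Val} {ℓ : Loc} (h : Reach S P c₀ ℓ c) :
    ∃ π : ExecPath S P, π.data 0 = c₀ ∧ π.loc π.len = ℓ ∧ π.data π.len = c := by
  induction h with
  | init =>
    -- The path has length 0, but `edge` is a total function and needs a dummy value; this is the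
    -- only use of `Nonempty`.
    exact ⟨⟨0, fun _ => P.init, fun _ => c₀, fun _ => (P.init, Classical.ofNonempty, P.init),
      rfl, by simp, by simp, by simp, by simp⟩, rfl, rfl, rfl⟩
  | step _ he hc ih =>
    obtain ⟨π, h0, rfl, rfl⟩ := ih
    exact ⟨π.snoc he hc, by simpa [ExecPath.snoc] using h0, by simp [ExecPath.snoc],
      by simp [ExecPath.snoc]⟩

/-- An initial data state without erroneous execution does not lead to the error location. -/
theorem Reach.ne_err [Nonempty (Op Cond Asgn)] {S : Semantics Var Val Cond Asgn}
    {P : CFA Loc Cond Asgn} {c₀ c : Var → Val} {ℓ : Loc} (h : Reach S P c₀ ℓ c)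
    (hno : ¬ ∃ π ∈ pathsErr S P, c₀ = π.data 0) : ℓ ≠ P.err := by
  rintro rfl
  obtain ⟨π, h0, hl, -⟩ := h.exists_execPath
  exact hno ⟨π, ⟨π.len, le_rfl, hl⟩, h0.symm⟩

/-! ### Resynchronization -/

theorem CFA.Deterministic.eq_of_assign {S : Semantics Var Val Cond Asgn} {P : CFA Loc Cond Asgn}
    (hP : P.Deterministic S) {ℓ ℓ₁ ℓ₂ : Loc} {a : Asgn} {op : Op Cond Asgn}
    (h₁ : (ℓ, .assign a, ℓ₁) ∈ P.edges) (h₂ : (ℓ, op, ℓ₂) ∈ P.edges) :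
    op = .assign a ∧ ℓ₂ = ℓ₁ := by
  rcases hP _ _ _ _ _ h₁ h₂ with ⟨rfl, rfl⟩ | ⟨b₁, b₂, h, -⟩
  · exact ⟨rfl, rfl⟩
  · cases h

/-- The loop's choice of locations never consults the variable set, and determinism leaves at most
one assignment edge to skip. Hence explorations with different modified variables resynchronize at
the same location. -/
theorem Resync.loc_unique {S : Semantics Var Val Cond Asgn} {P : CFA Loc Cond Asgn}
    (hP : P.Deterministic S) {ℓ ℓ₁ ℓ₂ : Loc} {V₁ V₂ W₁ W₂ : Set Var}
    (h₁ : Resync S P ℓ V₁ ℓ₁ W₁) (h₂ : Resync S P ℓ V₂ ℓ₂ W₂) : ℓ₁ = ℓ₂ := by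
  induction h₁ generalizing V₂ with
  | done hd =>
    cases h₂ with
    | done => rfl
    | skip hne he _ => exact absurd ⟨hne, _, _, he⟩ hd
  | skip hne he _ ih =>
    cases h₂ with
    | done hd => exact absurd ⟨hne, _, _, he⟩ hd
    | skip _ he' h =>
      obtain ⟨-, rfl⟩ := hP.eq_of_assign he he'
      exact ih h

/-- The loop follows an execution of `P`, and collects all variables that it may change. -/
theorem Resync.exists_reach {S : Semantics Var Val Cond Asgn} {P : CFA Loc Cond Asgn}
    {c₀ c c' : Var → Val} {ℓ ℓp : Loc} {V W : Set Var} (h : Resync S P ℓ V ℓp W)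
    (hr : Reach S P c₀ ℓ c) (hc : ∀ x ∉ V, c x = c' x) :
    ∃ d, Reach S P c₀ ℓp d ∧ ∀ x ∉ W, d x = c' x := by
  induction h generalizing c with
  | done => exact ⟨c, hr, hc⟩
  | @skip ℓ V a ℓs ℓp W _ he _ ih =>
    refine ih (hr.step he (c' := S.post a c) rfl) fun x hx => ?_
    rw [Set.mem_union, not_or] at hx
    rw [S.post_eq_of_notMem_writ a c x hx.2, hc x hx.1]

theorem Matches.sat {S : Semantics Var Val Cond Asgn} {b b' : Cond} (h : Matches S b b')
    {c : Var → Val} (hc : S.Sat c b') : S.Sat c b := by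
  rcases h with rfl | ⟨h, -⟩
  · exact hc
  · exact h c hc

/-! ### Successors computed by the detector -/

/-- `Successor S P n V g' t W`: with modified variables `V` at the alignment point `n`, exploring
the edge `g'` may lead to a call of `process` with successor `t` and modified variables `W`.  In
the affected cases the conditions that soundness does not depend on are omitted. -/
inductive Successor (S : Semantics Var Val Cond Asgn) (P : CFA Loc Cond Asgn) (n : Loc × Loc')
    (V : Set Var) : Edge Loc' Cond Asgn → Node Loc Loc' → Set Var → Prop
  | assignMatchAffected {a ℓ₂ ℓ₂'} :
      (n.1, Op.assign a, ℓ₂) ∈ P.edges →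
      Successor S P n V (n.2, .assign a, ℓ₂') (.aligned (ℓ₂, ℓ₂')) (V ∪ S.writ a)
  | assignMatchUnaffected {a ℓ₂ ℓ₂'} :
      (n.1, Op.assign a, ℓ₂) ∈ P.edges → V ∩ S.rdAsgn a = ∅ →
      Successor S P n V (n.2, .assign a, ℓ₂') (.aligned (ℓ₂, ℓ₂')) (V \ S.writ a)
  | assignNew {a ℓ₂'} :
      (¬ ∃ ℓ₂, (n.1, Op.assign a, ℓ₂) ∈ P.edges) →
      Successor S P n V (n.2, .assign a, ℓ₂') (.aligned (n.1, ℓ₂')) (V ∪ S.writ a)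
  | assumeMatchAffected {b' ℓ₂'} :
      Successor S P n V (n.2, .assume b', ℓ₂') (.indicator ℓ₂') ∅
  | assumeMatchUnaffected {b' ℓ₂' ℓp W b ℓ₂} :
      Resync S P n.1 V ℓp W →
      ℓp ≠ P.err → (ℓp, Op.assume b, ℓ₂) ∈ P.edges → Matches S b b' →
      W ∩ (S.rdCond b ∪ S.rdCond b') = ∅ →
      Successor S P n V (n.2, .assume b', ℓ₂') (.aligned (ℓ₂, ℓ₂')) W
  | assumeNew {b' ℓ₂' ℓp W} :
      Resync S P n.1 V ℓp W →
      ¬ (ℓp ≠ P.err ∧ ∃ b ℓ₂, (ℓp, Op.assume b, ℓ₂) ∈ P.edges ∧ Matches S b b') →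
      Successor S P n V (n.2, .assume b', ℓ₂') (.aligned (ℓp, ℓ₂')) W

theorem ExploreEdge.exists_successor {S : Semantics Var Val Cond Asgn} {P : CFA Loc Cond Asgn}
    {P' : CFA Loc' Cond Asgn} {n : Loc × Loc'} {g' : Edge Loc' Cond Asgn}
    {s t : State Var Cond Asgn Loc Loc'} (h : ExploreEdge S P P' n g' s t) :
    ∃ m W, Successor S P n (s.modified n) g' m W ∧ t = s.process P P' n g' m W := by
  cases h with
  | assignMatchAffected he _ => exact ⟨_, _, .assignMatchAffected he, rfl⟩
  | assignMatchUnaffected he hv => exact ⟨_, _, .assignMatchUnaffected he hv, rfl⟩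
  | assignNew he => exact ⟨_, _, .assignNew he, rfl⟩
  | assumeMatchAffected => exact ⟨_, _, .assumeMatchAffected, rfl⟩
  | assumeMatchUnaffected hr hne he hm hv =>
    exact ⟨_, _, .assumeMatchUnaffected hr hne he hm hv, rfl⟩
  | assumeNew hr he => exact ⟨_, _, .assumeNew hr he, rfl⟩

theorem Successor.snd_eq {S : Semantics Var Val Cond Asgn} {P : CFA Loc Cond Asgn}
    {n m : Loc × Loc'} {V W : Set Var} {g' : Edge Loc' Cond Asgn}
    (h : Successor S P n V g' (.aligned m) W) : m.2 = g'.2.2 := by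
  cases h <;> rfl

/-- Apart from indicator nodes, the successor along an executable edge does not depend on the
modified variables. -/
theorem Successor.unique {S : Semantics Var Val Cond Asgn} {P : CFA Loc Cond Asgn}
    (hP : P.Deterministic S) {n m : Loc × Loc'} {V₁ V₂ W₁ W₂ : Set Var}
    {g' : Edge Loc' Cond Asgn} {t : Node Loc Loc'} {c c' : Var → Val}
    (hstep : OpStep S g'.2.1 c c') (h₁ : Successor S P n V₁ g' (.aligned m) W₁)
    (h₂ : Successor S P n V₂ g' t W₂) : t = .indicator m.2 ∨ t = .aligned m := by
  cases h₁ with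
  | assignMatchAffected he =>
    cases h₂ with
    | assignMatchAffected he' | assignMatchUnaffected he' _ =>
      obtain ⟨-, rfl⟩ := hP.eq_of_assign he he'
      exact .inr rfl
    | assignNew hn => exact absurd ⟨_, he⟩ hn
  | assignMatchUnaffected he _ =>
    cases h₂ with
    | assignMatchAffected he' | assignMatchUnaffected he' _ =>
      obtain ⟨-, rfl⟩ := hP.eq_of_assign he he'
      exact .inr rfl
    | assignNew hn => exact absurd ⟨_, he⟩ hn
  | assignNew hn =>
    cases h₂ with
    | assignMatchAffected he' | assignMatchUnaffected he' _ => exact absurd ⟨_, he'⟩ hn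
    | assignNew _ => exact .inr rfl
  | assumeMatchUnaffected hr hne he hm _ =>
    cases h₂ with
    | assumeMatchAffected => exact .inl rfl
    | assumeMatchUnaffected hr' _ he' hm' _ =>
      obtain rfl := hr.loc_unique hP hr'
      rcases hP _ _ _ _ _ he he' with ⟨-, rfl⟩ | ⟨b₁, b₂, h₁, h₂, hneg⟩
      · exact .inr rfl
      · cases h₁
        cases h₂
        -- Two different matching edges would carry complementary conditions, yet both hold in `c`,
        -- because `c` satisfies the condition of `g'` that implies them. Executability of the edge
        -- is essential here.
        exact absurd (hm'.sat hstep.1) ((hneg c).1 (hm.sat hstep.1))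
    | assumeNew hr' hn =>
      obtain rfl := hr.loc_unique hP hr'
      exact absurd ⟨hne, _, _, he, hm⟩ hn
  | assumeNew hr hn =>
    cases h₂ with
    | assumeMatchAffected => exact .inl rfl
    | assumeMatchUnaffected hr' hne he hm _ =>
      obtain rfl := hr.loc_unique hP hr'
      exact absurd ⟨hne, _, _, he, hm⟩ hn
    | assumeNew hr' _ =>
      obtain rfl := hr.loc_unique hP hr'
      exact .inr rfl

/-- Simulation: `P` can follow a step of the modified program to the aligned successor, and the
data states then agree outside the modified variables. -/
theorem Successor.exists_reach {S : Semantics Var Val Cond Asgn} {P : CFA Loc Cond Asgn}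
    {n m : Loc × Loc'} {V W : Set Var} {g' : Edge Loc' Cond Asgn} {c₀ c c' d' : Var → Val}
    (h : Successor S P n V g' (.aligned m) W) (hr : Reach S P c₀ n.1 c)
    (hc : ∀ x ∉ V, c x = c' x) (hstep : OpStep S g'.2.1 c' d') :
    ∃ d, Reach S P c₀ m.1 d ∧ ∀ x ∉ W, d x = d' x := by
  cases h with
  | @assignMatchAffected a _ _ he =>
    obtain rfl : d' = S.post a c' := hstep
    refine ⟨S.post a c, hr.step he rfl, fun x hx => ?_⟩
    rw [Set.mem_union, not_or] at hx
    rw [S.post_eq_of_notMem_writ a c x hx.2, S.post_eq_of_notMem_writ a c' x hx.2, hc x hx.1]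
  | @assignMatchUnaffected a _ _ he hv =>
    obtain rfl : d' = S.post a c' := hstep
    refine ⟨S.post a c, hr.step he rfl, fun x hx => ?_⟩
    by_cases hw : x ∈ S.writ a
    -- No variable read by `a` is modified, so both runs write equal values; this justifies removing
    -- `writ a` from the modified set.
    · exact S.post_congr a c c' (fun y hy => hc y fun hV => hv.subset ⟨hV, hy⟩) x hw
    · rw [S.post_eq_of_notMem_writ a c x hw, S.post_eq_of_notMem_writ a c' x hw,
        hc x fun hV => hx ⟨hV, hw⟩]
  | @assignNew a _ _ =>
    obtain rfl : d' = S.post a c' := hstep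
    refine ⟨c, hr, fun x hx => ?_⟩
    rw [Set.mem_union, not_or] at hx
    rw [S.post_eq_of_notMem_writ a c' x hx.2, hc x hx.1]
  | @assumeMatchUnaffected b' _ _ _ _ _ hrs _ he hm hv =>
    obtain ⟨hsat, rfl⟩ := hstep
    obtain ⟨d, hd, hdc⟩ := hrs.exists_reach hr hc
    -- `b'` is known to hold only in the state of `P'`; it transfers to `P` because its read set
    -- avoids `W`.
    have hsat' : S.Sat d b' :=
      (S.sat_congr b' d d' fun x hx => hdc x fun hW => hv.subset ⟨hW, .inr hx⟩).2 hsat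
    exact ⟨d, hd.step he ⟨hm.sat hsat', rfl⟩, hdc⟩
  | assumeNew hrs _ =>
    obtain ⟨-, rfl⟩ := hstep
    exact hrs.exists_reach hr hc

/-! ### The loop invariant -/

/-- The detector state `s` reflects a call `process (n, g', t) W`. -/
def State.Records (P : CFA Loc Cond Asgn) (P' : CFA Loc' Cond Asgn)
    (s : State Var Cond Asgn Loc Loc') (n : Loc × Loc') (g' : Edge Loc' Cond Asgn) :
    Node Loc Loc' → Set Var → Prop
  | .indicator ℓ', _ => (.aligned n, g', .indicator ℓ') ∈ s.edges ∧ ℓ' ∈ s.bad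
  | .aligned m, W =>
    ((m.1 ≠ P.err ∧ m.2 = P'.err) ∧ (.aligned n, g', .indicator m.2) ∈ s.edges ∧ m.2 ∈ s.bad) ∨
    (¬ (m.1 ≠ P.err ∧ m.2 = P'.err) ∧ (.aligned n, g', .aligned m) ∈ s.edges ∧
      (m.2 ∈ s.bad ∨ m ∈ s.visited ∧ W ⊆ s.modified m))

/-- `t` extends the information of `s`; visited alignment points are only given up for
indicators. -/
structure State.Le (s t : State Var Cond Asgn Loc Loc') : Prop where
  edges : s.edges ⊆ t.edges
  bad : s.bad ⊆ t.bad
  modified : ∀ n, s.modified n ⊆ t.modified n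
  visited : ∀ n ∈ s.visited, n ∈ t.visited ∨ n.2 ∈ t.bad

/-- Evicting a visited target makes its location bad, which is the other alternative that `Records`
allows. -/
theorem State.Records.mono {P : CFA Loc Cond Asgn} {P' : CFA Loc' Cond Asgn}
    {s t : State Var Cond Asgn Loc Loc'} (hst : s.Le t) {n : Loc × Loc'}
    {g' : Edge Loc' Cond Asgn} {m : Node Loc Loc'} {W : Set Var}
    (h : s.Records P P' n g' m W) : t.Records P P' n g' m W := by
  cases m with
  | indicator ℓ' => exact ⟨hst.edges h.1, hst.bad h.2⟩
  | aligned m =>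
    rcases h with ⟨h, he, hb⟩ | ⟨h, he, hb | ⟨hv, hW⟩⟩
    · exact .inl ⟨h, hst.edges he, hst.bad hb⟩
    · exact .inr ⟨h, hst.edges he, .inl (hst.bad hb)⟩
    · refine .inr ⟨h, hst.edges he, ?_⟩
      rcases hst.visited m hv with hv | hb
      · exact .inr ⟨hv, hW.trans (hst.modified m)⟩
      · exact .inl hb

theorem State.le_processIndicator (s : State Var Cond Asgn Loc Loc') (n : Loc × Loc')
    (g' : Edge Loc' Cond Asgn) (ℓ' : Loc') : s.Le (s.processIndicator n g' ℓ') where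
  edges := Set.subset_union_left
  bad := Set.subset_union_left
  modified _ := subset_rfl
  visited m hm := by
    by_cases h : m.2 = ℓ'
    · exact .inr (.inr h)
    · exact .inl ⟨hm, h⟩

theorem State.process_aligned_of_err {P : CFA Loc Cond Asgn} {P' : CFA Loc' Cond Asgn}
    (s : State Var Cond Asgn Loc Loc') (n m : Loc × Loc') (g' : Edge Loc' Cond Asgn) (W : Set Var)
    (h : m.1 ≠ P.err ∧ m.2 = P'.err) :
    s.process P P' n g' (.aligned m) W = s.processIndicator n g' m.2 := by
  rw [State.process, if_pos h, h.2]

theorem State.le_process (P : CFA Loc Cond Asgn) (P' : CFA Loc' Cond Asgn)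
    (s : State Var Cond Asgn Loc Loc') (n : Loc × Loc') (g' : Edge Loc' Cond Asgn)
    (m : Node Loc Loc') (W : Set Var) : s.Le (s.process P P' n g' m W) := by
  cases m with
  | indicator ℓ' => exact s.le_processIndicator n g' ℓ'
  | aligned m =>
    by_cases h : m.1 ≠ P.err ∧ m.2 = P'.err
    · rw [s.process_aligned_of_err n m g' W h]
      exact s.le_processIndicator n g' m.2
    · rw [State.process, if_neg h]
      refine ⟨Set.subset_union_left, subset_rfl, fun k => ?_, fun k hk => .inl ?_⟩
      · dsimp only
        split_ifs
        exacts [Set.subset_union_left, subset_rfl]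
      · dsimp only
        split_ifs
        exacts [hk, .inl hk]

theorem State.records_process (P : CFA Loc Cond Asgn) (P' : CFA Loc' Cond Asgn)
    (s : State Var Cond Asgn Loc Loc') (n : Loc × Loc') (g' : Edge Loc' Cond Asgn)
    (m : Node Loc Loc') (W : Set Var) : (s.process P P' n g' m W).Records P P' n g' m W := by
  cases m with
  | indicator ℓ' => exact ⟨.inr rfl, .inr rfl⟩
  | aligned m =>
    by_cases h : m.1 ≠ P.err ∧ m.2 = P'.err
    · rw [s.process_aligned_of_err n m g' W h]
      exact .inl ⟨h, .inr rfl, .inr rfl⟩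
    · rw [State.process, if_neg h]
      refine .inr ⟨h, .inr rfl, ?_⟩
      by_cases hb : m.2 ∈ s.bad
      · exact .inl hb
      · simp [hb]

/-- Alignment points that need no further exploration after `process` needed none before, and
their modified variables are unchanged. -/
theorem State.process_settled {P : CFA Loc Cond Asgn} {P' : CFA Loc' Cond Asgn}
    {s : State Var Cond Asgn Loc Loc'} {n k : Loc × Loc'} {g' : Edge Loc' Cond Asgn}
    {m : Node Loc Loc'} {W : Set Var} (hv : k ∈ (s.process P P' n g' m W).visited)
    (hk : k.1 ≠ P.err) (hw : k ∉ (s.process P P' n g' m W).waitlist) :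
    k ∈ s.visited ∧ k ∉ s.waitlist ∧ (s.process P P' n g' m W).modified k = s.modified k := by
  cases m with
  | indicator ℓ' => exact ⟨hv.1, fun h => hw ⟨h, hv.2⟩, rfl⟩
  | aligned m =>
    by_cases h : m.1 ≠ P.err ∧ m.2 = P'.err
    · rw [s.process_aligned_of_err n m g' W h] at *
      exact ⟨hv.1, fun h => hw ⟨h, hv.2⟩, rfl⟩
    · rw [State.process, if_neg h] at *
      dsimp only at *
      by_cases hkm : k = m
      · subst hkm
        by_cases hb : k.2 ∈ s.bad
        · simp_all
        · by_cases hn : k ∉ s.visited ∨ ¬ W ⊆ s.modified k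
          · simp_all
          -- Here `k` was visited and `W ⊆ s.modified k`, so the update adds nothing; otherwise `k`
          -- would have entered the waitlist.
          · push Not at hn
            simp_all
      · have : ∀ A : Set (Loc × Loc'), k ∈ A ∪ {m} ↔ k ∈ A := by simp [hkm]
        split_ifs at * <;> simp_all

/-- Invariant of the detector, where the edges in `pending` are still to be explored. -/
structure Invariant (S : Semantics Var Val Cond Asgn) (P : CFA Loc Cond Asgn)
    (P' : CFA Loc' Cond Asgn) (s : State Var Cond Asgn Loc Loc')
    (pending : Set ((Loc × Loc') × Edge Loc' Cond Asgn)) : Prop where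
  init_visited : (P.init, P'.init) ∈ s.visited ∨ P'.init ∈ s.bad
  notMem_bad : ∀ n ∈ s.visited, n.2 ∉ s.bad
  err : ∀ n ∈ s.visited, n.2 = P'.err → n.1 = P.err ∨ n = (P.init, P'.init)
  edge_successor : ∀ n m g', (.aligned n, g', .aligned m) ∈ s.edges →
    ∃ V W, Successor S P n V g' (.aligned m) W
  explored : ∀ n ∈ s.visited, n.1 ≠ P.err → n ∉ s.waitlist → ∀ g' ∈ P'.edges, g'.1 = n.2 →
    (n, g') ∉ pending →
      ∃ m W, Successor S P n (s.modified n) g' m W ∧ s.Records P P' n g' m W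

theorem invariant_start (S : Semantics Var Val Cond Asgn) (P : CFA Loc Cond Asgn)
    (P' : CFA Loc' Cond Asgn) : Invariant S P P' (State.start P P') ∅ where
  init_visited := .inl rfl
  notMem_bad _ _ := id
  err _ hn _ := .inr hn
  edge_successor _ _ _ h := h.elim
  explored _ hn _ hw := absurd hn hw

/-- The popped point may itself be the successor. If its modified set grows, it returns to the
waitlist and `explored` claims nothing about it; otherwise `State.process_settled` shows that the
set used for its earlier edges is still current. -/
theorem Invariant.process {S : Semantics Var Val Cond Asgn} {P : CFA Loc Cond Asgn}
    {P' : CFA Loc' Cond Asgn} {s : State Var Cond Asgn Loc Loc'}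
    {pending : Set ((Loc × Loc') × Edge Loc' Cond Asgn)} (hs : Invariant S P P' s pending)
    {n : Loc × Loc'} {g' : Edge Loc' Cond Asgn} {m : Node Loc Loc'} {W : Set Var}
    (hm : Successor S P n (s.modified n) g' m W) :
    Invariant S P P' (s.process P P' n g' m W) (pending \ {(n, g')}) := by
  have hle := s.le_process P P' n g' m W
  have hrec := s.records_process P P' n g' m W
  have hexpl : ∀ k ∈ (s.process P P' n g' m W).visited, k.1 ≠ P.err →
      k ∉ (s.process P P' n g' m W).waitlist → ∀ h' ∈ P'.edges, h'.1 = k.2 →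
      (k, h') ∉ pending \ {(n, g')} →
      ∃ t U, Successor S P k ((s.process P P' n g' m W).modified k) h' t U ∧
        (s.process P P' n g' m W).Records P P' k h' t U := by
    intro k hk hke hkw h' hh' hsrc hpend
    obtain ⟨hv, hw, hmod⟩ := State.process_settled hk hke hkw
    rw [hmod]
    by_cases heq : (k, h') = (n, g')
    · obtain ⟨rfl, rfl⟩ := Prod.mk.inj heq
      exact ⟨m, W, hm, hrec⟩
    · obtain ⟨t, U, ht, hr⟩ := hs.explored k hv hke hw h' hh' hsrc fun h => hpend ⟨h, heq⟩
      exact ⟨t, U, ht, hr.mono hle⟩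
  have hinit : (P.init, P'.init) ∈ (s.process P P' n g' m W).visited ∨
      P'.init ∈ (s.process P P' n g' m W).bad :=
    hs.init_visited.elim (hle.visited _) fun h => .inr (hle.bad h)
  -- Stated for every `ℓ'`, this serves both explicit indicators and aligned successors redirected
  -- to one.
  have hind : ∀ ℓ', (∀ k ∈ (s.processIndicator n g' ℓ').visited,
        k.2 ∉ (s.processIndicator n g' ℓ').bad) ∧
      (∀ k ∈ (s.processIndicator n g' ℓ').visited, k.2 = P'.err →
        k.1 = P.err ∨ k = (P.init, P'.init)) ∧
      ∀ k l h', (.aligned k, h', .aligned l) ∈ (s.processIndicator n g' ℓ').edges →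
        ∃ V W, Successor S P k V h' (.aligned l) W := by
    refine fun ℓ' => ⟨fun k hk hb => hb.elim (hs.notMem_bad k hk.1) hk.2,
      fun k hk => hs.err k hk.1, fun k l h' he => ?_⟩
    rcases he with he | he
    · exact hs.edge_successor k l h' he
    · simp at he
  cases m with
  | indicator ℓ' => exact ⟨hinit, (hind ℓ').1, (hind ℓ').2.1, (hind ℓ').2.2, hexpl⟩
  | aligned m =>
    by_cases h : m.1 ≠ P.err ∧ m.2 = P'.err
    · rw [s.process_aligned_of_err n m g' W h] at *
      exact ⟨hinit, (hind m.2).1, (hind m.2).2.1, (hind m.2).2.2, hexpl⟩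
    · have hvis : ∀ k ∈ (s.process P P' n g' (.aligned m) W).visited,
          k ∈ s.visited ∨ k = m ∧ m.2 ∉ s.bad := by
        intro k hk
        rw [State.process, if_neg h] at hk
        dsimp only at hk
        split_ifs at hk with hb
        · exact .inl hk
        · exact hk.imp_right fun hk => ⟨hk, hb⟩
      refine ⟨hinit, fun k hk hb => ?_, fun k hk hke => ?_, fun k l h' he => ?_, hexpl⟩
      · rw [State.process, if_neg h] at hb
        rcases hvis k hk with hk | ⟨rfl, hm⟩
        exacts [hs.notMem_bad k hk hb, hm hb]
      · rcases hvis k hk with hk | ⟨rfl, -⟩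
        · exact hs.err k hk hke
        · exact .inl (by_contra fun hne => h ⟨hne, hke⟩)
      · rw [State.process, if_neg h] at he
        rcases he with he | he
        · exact hs.edge_successor k l h' he
        · simp only [Set.mem_singleton_iff, Prod.mk.injEq, Node.aligned.injEq] at he
          obtain ⟨rfl, rfl, rfl⟩ := he
          exact ⟨_, _, hm⟩

theorem Invariant.exploreEdges {S : Semantics Var Val Cond Asgn} {P : CFA Loc Cond Asgn}
    {P' : CFA Loc' Cond Asgn} {n : Loc × Loc'} {gs : List (Edge Loc' Cond Asgn)}
    {s t : State Var Cond Asgn Loc Loc'} (h : ExploreEdges S P P' n gs s t)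
    (hs : Invariant S P P' s {p | p.1 = n ∧ p.2 ∈ gs}) : Invariant S P P' t ∅ := by
  induction h with
  | nil => simpa using hs
  | @cons g' gs s t u he _ ih =>
    obtain ⟨m, W, hm, rfl⟩ := he.exists_successor
    have := hs.process hm
    refine ih { this with explored := fun k hk hke hkw h' hh' hsrc hp => ?_ }
    refine this.explored k hk hke hkw h' hh' hsrc ?_
    rintro ⟨⟨rfl, hmem⟩, hne⟩
    rcases List.mem_cons.1 hmem with rfl | hmem
    exacts [hne rfl, hp ⟨rfl, hmem⟩]

theorem Invariant.iteration {S : Semantics Var Val Cond Asgn} {P : CFA Loc Cond Asgn}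
    {P' : CFA Loc' Cond Asgn} {s t : State Var Cond Asgn Loc Loc'}
    (hs : Invariant S P P' s ∅) (h : Iteration S P P' s t) : Invariant S P P' t ∅ := by
  obtain ⟨n, -, gs, -, hgs, hex⟩ := h
  refine Invariant.exploreEdges hex
    ⟨hs.init_visited, hs.notMem_bad, hs.err, hs.edge_successor, ?_⟩
  intro k hk hke hkw h' hh' hsrc hp
  -- Popping shrinks the waitlist only at `n`, whose outgoing edges are all pending.
  refine hs.explored k hk hke (fun hw => hkw ⟨hw, ?_⟩) h' hh' hsrc id
  rintro rfl
  exact hp ⟨rfl, (hgs h').2 ⟨hh', hsrc⟩⟩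

theorem invariant_of_reflTransGen {S : Semantics Var Val Cond Asgn} {P : CFA Loc Cond Asgn}
    {P' : CFA Loc' Cond Asgn} {s : State Var Cond Asgn Loc Loc'}
    (h : Relation.ReflTransGen (Iteration S P P') (State.start P P') s) :
    Invariant S P P' s ∅ := by
  induction h with
  | refl => exact invariant_start S P P'
  | tail _ hit ih => exact ih.iteration hit

/-! ### The returned graph -/

/-- Some node in `Δ` is reachable from `n`. -/
def Graph.ReachesIndicator {Node Label : Type*} (D : Graph Node Label) (n : Node) : Prop :=
  ∃ (m : ℕ) (node : ℕ → Node) (label : ℕ → Label),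
    node 0 = n ∧ D.IsWalk m node label ∧ node m ∈ D.Δ

theorem Graph.ReachesIndicator.of_mem {Node Label : Type*} {D : Graph Node Label} {n : Node}
    (hn : n ∈ D.Δ) (hD : D.Δ ⊆ D.nodes) (l : Label) : D.ReachesIndicator n :=
  ⟨0, fun _ => n, fun _ => l, rfl, ⟨fun _ _ => hD hn, by simp⟩, hn⟩

theorem Graph.ReachesIndicator.of_edge {Node Label : Type*} {D : Graph Node Label} {n n' : Node}
    {l : Label} (he : (n, l, n') ∈ D.edges) (hn : n ∈ D.nodes) (h : D.ReachesIndicator n') :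
    D.ReachesIndicator n := by
  obtain ⟨m, node, label, rfl, ⟨hnode, hedge⟩, hm⟩ := h
  -- `casesOn` prepends `n` and `l`, shifting the given walk by one.
  refine ⟨m + 1, fun i => i.casesOn n node, fun i => i.casesOn l label, rfl, ⟨?_, ?_⟩, hm⟩
  · rintro (_ | i) hi
    exacts [hn, hnode i (by omega)]
  · rintro (_ | i) hi
    exacts [he, hedge i (by omega)]

/-- `P` can be executed from `c₀` to `n.1` such that the data state agrees with `c'` on the
variables that are not recorded as modified. -/
def State.Follows (S : Semantics Var Val Cond Asgn) (P : CFA Loc Cond Asgn)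
    (s : State Var Cond Asgn Loc Loc') (c₀ c' : Var → Val) (n : Loc × Loc') : Prop :=
  ∃ c, Reach S P c₀ n.1 c ∧ ∀ x ∉ s.modified n, c x = c' x

/-- The recorded edge may be outdated, so its own variable set is useless. The latest exploration
has the same target, and its set is contained in `modified m`; its remaining outcomes would put the
location of `m` into `bad`, contradicting that `m` is visited. -/
theorem Invariant.follows_step {S : Semantics Var Val Cond Asgn} {P : CFA Loc Cond Asgn}
    {P' : CFA Loc' Cond Asgn} {s : State Var Cond Asgn Loc Loc'} (hs : Invariant S P P' s ∅)
    (hw : s.waitlist = ∅) (hP : P.Deterministic S) {n m : Loc × Loc'} {g' : Edge Loc' Cond Asgn}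
    {c₀ c' d' : Var → Val} (hn : n ∈ s.visited) (hm : m ∈ s.visited) (hne : n.1 ≠ P.err)
    (hg : g' ∈ P'.edges) (hsrc : g'.1 = n.2) (he : (.aligned n, g', .aligned m) ∈ s.edges)
    (hstep : OpStep S g'.2.1 c' d') (h : s.Follows S P c₀ c' n) :
    m.2 = g'.2.2 ∧ s.Follows S P c₀ d' m := by
  obtain ⟨V, W, hVW⟩ := hs.edge_successor n m g' he
  obtain ⟨t, U, ht, hrec⟩ := hs.explored n hn hne (by simp [hw]) g' hg hsrc id
  refine ⟨hVW.snd_eq, ?_⟩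
  rcases hVW.unique hP hstep ht with rfl | rfl
  · exact absurd hrec.2 (hs.notMem_bad m hm)
  · rcases hrec with ⟨-, -, hb⟩ | ⟨-, -, hb | ⟨-, hU⟩⟩
    · exact absurd hb (hs.notMem_bad m hm)
    · exact absurd hb (hs.notMem_bad m hm)
    · obtain ⟨c, hr, hc⟩ := h
      obtain ⟨d, hd, hdd⟩ := ht.exists_reach hr hc hstep
      exact ⟨d, hd, fun x hx => hdd x fun hxU => hx (hU hxU)⟩

/-- The graph returned unless the initial location becomes an indicator. -/
def State.graph (P : CFA Loc Cond Asgn) (P' : CFA Loc' Cond Asgn)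
    (s : State Var Cond Asgn Loc Loc') : Graph (Node Loc Loc') (Edge Loc' Cond Asgn) where
  nodes := Node.aligned '' s.visited ∪ Node.indicator '' s.bad
  edges := {e | e.1 ∈ Node.aligned '' s.visited ∧ e.2.1 ∈ P'.edges ∧
    e.2.2 ∈ Node.aligned '' s.visited ∪ Node.indicator '' s.bad ∧
    (e ∈ s.edges ∨
      ∃ ℓ' ∈ s.bad, e.2.2 = .indicator ℓ' ∧
        ∃ ℓ, (e.1, e.2.1, Node.aligned (ℓ, ℓ')) ∈ s.edges)}
  init := .aligned (P.init, P'.init)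
  Δ := Node.indicator '' s.bad

theorem Invariant.reachesIndicator {S : Semantics Var Val Cond Asgn} {P : CFA Loc Cond Asgn}
    {P' : CFA Loc' Cond Asgn} {s : State Var Cond Asgn Loc Loc'} (hs : Invariant S P P' s ∅)
    (hw : s.waitlist = ∅) (hP : P.Deterministic S)
    (hinit : ¬ (P'.init = P'.err ∧ P.init ≠ P.err)) {π' : ExecPath S P'}
    (hno : ¬ ∃ π ∈ pathsErr S P, π'.data 0 = π.data 0) {j : ℕ} (hj : j ≤ π'.len)
    (herr : π'.loc j = P'.err) {k : ℕ} (hk : k ≤ j) {n : Loc × Loc'} (hn : n ∈ s.visited)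
    (hloc : n.2 = π'.loc k) (h : s.Follows S P (π'.data 0) (π'.data k) n) :
    (s.graph P P').ReachesIndicator (.aligned n) := by
  have : Nonempty (Op Cond Asgn) := ⟨(π'.edge 0).2.1⟩
  have hne : n.1 ≠ P.err := by
    obtain ⟨c, hr, -⟩ := h
    exact hr.ne_err hno
  have hne' : n.2 ≠ P'.err := by
    intro h'
    rcases hs.err n hn h' with h | rfl
    exacts [hne h, hinit ⟨h', hne⟩]
  have hnn : Node.aligned n ∈ (s.graph P P').nodes := .inl ⟨n, hn, rfl⟩
  have hkj : k < j := lt_of_le_of_ne hk fun hkj => hne' (by rw [hloc, hkj, herr])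
  -- Downward induction from the error position `j`. The base case is void, since a visited point
  -- there would pair `P'.err` with a location other than `P.err`.
  induction hk using Nat.decreasingInduction generalizing n with
  | self => exact absurd hkj (lt_irrefl _)
  | of_succ k hk' ih =>
    have hklen : k < π'.len := by omega
    have hg := π'.edge_mem k hklen
    have hsrc : (π'.edge k).1 = n.2 := (π'.edge_src k hklen).trans hloc.symm
    obtain ⟨t, W, ht, hrec⟩ := hs.explored n hn hne (by simp [hw]) _ hg hsrc id
    have hind : ∀ ℓ' ∈ s.bad, ((.aligned n, π'.edge k, .indicator ℓ') ∈ s.edges ∨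
        ∃ ℓ, (.aligned n, π'.edge k, .aligned (ℓ, ℓ')) ∈ s.edges) →
        (s.graph P P').ReachesIndicator (.aligned n) := by
      intro ℓ' hb he
      refine .of_edge (l := π'.edge k) (n' := .indicator ℓ')
        ⟨⟨n, hn, rfl⟩, hg, .inr ⟨ℓ', hb, rfl⟩, ?_⟩ hnn
        (.of_mem ⟨ℓ', hb, rfl⟩ Set.subset_union_right (π'.edge k))
      exact he.imp_right fun he => ⟨ℓ', hb, rfl, he⟩
    cases t with
    | indicator ℓ' => exact hind ℓ' hrec.2 (.inl hrec.1)
    | aligned m =>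
      rcases hrec with ⟨-, he, hb⟩ | ⟨-, he, hb | ⟨hm, -⟩⟩
      · exact hind m.2 hb (.inl he)
      -- The recorded target is aligned but its location is bad; the output redirects such edges to
      -- the indicator.
      · exact hind m.2 hb (.inr ⟨m.1, he⟩)
      · obtain ⟨hm2, hfm⟩ := hs.follows_step hw hP hn hm hne hg hsrc he (π'.step k hklen) h
        have hlocm : m.2 = π'.loc (k + 1) := hm2.trans (π'.edge_tgt k hklen)
        have hme : m.1 ≠ P.err := by
          obtain ⟨c, hr, -⟩ := hfm
          exact hr.ne_err hno
        have hme' : m.2 ≠ P'.err := by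
          intro h'
          rcases hs.err m hm h' with h | rfl
          exacts [hme h, hinit ⟨h', hme⟩]
        refine .of_edge (l := π'.edge k) ⟨⟨n, hn, rfl⟩, hg, .inl ⟨m, hm, rfl⟩, .inl he⟩ hnn ?_
        exact ih hm hlocm hfm hme hme' (.inl ⟨m, hm, rfl⟩)
          (lt_of_le_of_ne hk' fun hkj => hme' (by rw [hlocm, hkj, herr]))

/-- Graph edges start at aligned nodes, so all nodes before an aligned one are aligned and
`Invariant.follows_step` applies throughout. -/
theorem Invariant.follows_walk {S : Semantics Var Val Cond Asgn} {P : CFA Loc Cond Asgn}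
    {P' : CFA Loc' Cond Asgn} {s : State Var Cond Asgn Loc Loc'} (hs : Invariant S P P' s ∅)
    (hw : s.waitlist = ∅) (hP : P.Deterministic S) {π' : ExecPath S P'}
    (hno : ¬ ∃ π ∈ pathsErr S P, π'.data 0 = π.data 0) {k : ℕ} (hk : k ≤ π'.len)
    {node : ℕ → Node Loc Loc'} (h0 : node 0 = .aligned (P.init, P'.init))
    (hwalk : (s.graph P P').IsWalk k node π'.edge) {i : ℕ} (hi : i ≤ k) {n : Loc × Loc'}
    (hn : node i = .aligned n) :
    n.2 = π'.loc i ∧ s.Follows S P (π'.data 0) (π'.data i) n := by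
  have : Nonempty (Op Cond Asgn) := ⟨(π'.edge 0).2.1⟩
  induction i generalizing n with
  | zero =>
    obtain rfl := Node.aligned.inj (h0.symm.trans hn)
    exact ⟨π'.loc_zero.symm, _, .init, fun _ _ => rfl⟩
  | succ i ih =>
    have hilen : i < π'.len := by omega
    obtain ⟨⟨m, hm, hmi⟩, hg, ht, he⟩ := hwalk.2 i (by omega)
    dsimp only at hmi hg ht he
    rw [hn, ← hmi] at he
    rw [hn] at ht
    obtain ⟨hloc, hf⟩ := ih (by omega) hmi.symm
    have hme : m.1 ≠ P.err := by
      obtain ⟨c, hr, -⟩ := hf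
      exact hr.ne_err hno
    rcases ht with ⟨n', hn', hnn⟩ | ⟨_, -, hnn⟩
    · obtain rfl := Node.aligned.inj hnn
      rcases he with he | ⟨_, -, he, -⟩
      · obtain ⟨h2, hf'⟩ := hs.follows_step hw hP hm hn' hme hg
          ((π'.edge_src i hilen).trans hloc.symm) he (π'.step i hilen) hf
        exact ⟨h2.trans (π'.edge_tgt i hilen), hf'⟩
      · cases he
    · cases hnn

theorem Invariant.isDifferenceGraph {S : Semantics Var Val Cond Asgn} {P : CFA Loc Cond Asgn}
    {P' : CFA Loc' Cond Asgn} {s : State Var Cond Asgn Loc Loc'} (hs : Invariant S P P' s ∅)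
    (hw : s.waitlist = ∅) (hP : P.Deterministic S) (hbad : P'.init ∉ s.bad)
    (hinit : ¬ (P'.init = P'.err ∧ P.init ≠ P.err)) :
    IsDifferenceGraph S P P' (s.graph P P') where
  init_mem := .inl ⟨_, hs.init_visited.resolve_right hbad, rfl⟩
  indicator_subset := Set.subset_union_right
  edges_subset _ _ _ h := ⟨.inl h.1, h.2.1, h.2.2.1⟩
  sound := by
    rintro π' ⟨⟨j, hj, herr⟩, hno⟩ k hk node h0 hwalk
    change (s.graph P P').ReachesIndicator (node k)
    have : Nonempty (Op Cond Asgn) := ⟨(π'.edge 0).2.1⟩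
    rcases hwalk.1 k le_rfl with ⟨n, hn, hnk⟩ | hnk
    · obtain ⟨hloc, hf⟩ := hs.follows_walk hw hP hno hk h0 hwalk le_rfl hnk.symm
      -- A walk continuing past `j` would have an aligned source at position `j`, pairing `P'.err`
      -- with a location other than `P.err`.
      have hkj : k ≤ j := by
        by_contra! hjk
        obtain ⟨⟨m, hm, hmj⟩, -⟩ := hwalk.2 j hjk
        obtain ⟨hlocm, c, hr, -⟩ := hs.follows_walk hw hP hno hk h0 hwalk hjk.le hmj.symm
        have hme := hr.ne_err hno
        rcases hs.err m hm (hlocm.trans herr) with h | rfl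
        exacts [hme h, hinit ⟨hlocm.trans herr, hme⟩]
      rw [← hnk]
      exact hs.reachesIndicator hw hP hinit hno hj herr hkj hn hloc hf
    · exact .of_mem hnk Set.subset_union_right (π'.edge 0)

theorem isDifferenceGraph_singleton (S : Semantics Var Val Cond Asgn) (P : CFA Loc Cond Asgn)
    (P' : CFA Loc' Cond Asgn) {Node : Type*} (n : Node) :
    IsDifferenceGraph S P P' ⟨{n}, ∅, n, {n}⟩ where
  init_mem := rfl
  indicator_subset := subset_rfl
  edges_subset _ _ _ h := h.elim
  sound := fun π' _ k _ _ _ hwalk =>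
    Graph.ReachesIndicator.of_mem (hwalk.1 k le_rfl) subset_rfl (π'.edge 0)

end Soundness

end DiffVerif

theorem theorem2 {Var Val Cond Asgn Loc Loc' : Type*}
    (S : DiffVerif.Semantics Var Val Cond Asgn)
    (P : DiffVerif.CFA Loc Cond Asgn) (P' : DiffVerif.CFA Loc' Cond Asgn)
    (hP : P.Deterministic S) (hP' : P'.Deterministic S)
    (D : DiffVerif.Graph (DiffVerif.Node Loc Loc') (DiffVerif.Edge Loc' Cond Asgn))
    (hD : DiffVerif.DetectorReturns S P P' D) :
    DiffVerif.IsDifferenceGraph S P P' D := by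
  obtain ⟨s, hrun, hw, rfl⟩ := hD
  unfold DiffVerif.State.output
  split_ifs with h
  · exact DiffVerif.isDifferenceGraph_singleton S P P' _
  · rw [not_or] at h
    exact (DiffVerif.invariant_of_reflTransGen hrun).isDifferenceGraph hw hP h.1 h.2
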